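/- Let $X$ be an arbitrary real random variable, $d\ge 0$, $r\ge 1$. Write $\log$ for the natural logarithm, $\|X\|_p=(\mathbb E|X|^p)^{1/p}\in[0,\infty]$, $$\alpha_r = 2e^{1/r}\,\Gamma(1+\tfrac1r)\,r^{1/r},\qquad \beta_r=\sqrt{1+\frac{r^{2/r}\,\Gamma(3/r)}{\Gamma(1/r)}} .$$ Let $R_X(d)=\inf I(X;\hat X)$, the infimum over all transition probability kernels $P_{\hat X|X}$ from $\mathbb R$ to $\mathbb R$ with $\mathbb E|X-\hat X|^r\le d$; let $\underline R_X(d)=h(X)-\log(\alpha_r d^{1/r})$ be the Shannon lower bound, where $h(X)$ is the differential entropy ($h(X)=-\infty$ if $X$ has no density or the integral $-\int f\log f$ is of the form $\infty-\infty$); and let $D(X\|G_X)$ be the relative entropy between $X$ and a Gaussian $G_X\sim\mathcal N(0,\|X\|_2^2)$, with $D(X\|G_X)=+\infty$ if $\|X\|_2=\infty$. (In the differences, $\infty-\infty$ is read as $-\infty$; when $d>0$ and $D(X\|G_X)<\infty$, $\|X\|_2>0$, all terms are finite and no convention is involved.) 1) Let $r\in[1,2]$. If $\|X\|_2>d^{1/r}$,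 then $$R_X(d)-\underline R_X(d)\le D(X\|G_X)+\log\frac{\alpha_r}{\sqrt{2\pi e}} .$$ If $\|X\|_2\le d^{1/r}$, then $R_X(d)=0$. 2) Let $r>2$. If $\|X\|_2\ge d^{1/r}$ and $\|X\|_2>0$, then $$R_X(d)-\underline R_X(d)\le D(X\|G_X)+\log\beta_r .$$ If $\|X\|_r\le d^{1/r}$, then $R_X(d)=0$. If $\|X\|_r>d^{1/r}$ and $\|X\|_2<d^{1/r}$, then $$R_X(d)\le\log\frac{\sqrt{2\pi e}\,\beta_r}{\alpha_r}.$$ -/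

import Mathlib

open MeasureTheory ProbabilityTheory
open scoped ENNReal NNReal

noncomputable section

/-- `α_r = 2 e^{1/r} Γ(1 + 1/r) r^{1/r}`. -/
def rdAlpha (r : ℝ) : ℝ :=
  2 * Real.exp (1 / r) * Real.Gamma (1 + 1 / r) * r ^ (1 / r)

/-- `β_r = √(1 + r^{2/r} Γ(3/r) / Γ(1/r))`. -/
def rdBeta (r : ℝ) : ℝ :=
  Real.sqrt (1 + r ^ (2 / r) * Real.Gamma (3 / r) / Real.Gamma (1 / r))

open scoped Classical in
/-- Differential entropy (in nats) `h = -∫ f log f` of a law `μ` on `ℝ` with Lebesgue density `f`,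
as an extended real: the integral of the positive part of `-f log f` minus that of its negative
part (`-∞` if both are infinite). A law without a density has `h = -∞`. -/
def diffEntropy (μ : Measure ℝ) : EReal :=
  if μ ≪ volume then
    ((∫⁻ x, ENNReal.ofReal (Real.negMulLog (μ.rnDeriv volume x).toReal) : ℝ≥0∞) : EReal)
      - ((∫⁻ x, ENNReal.ofReal (-Real.negMulLog (μ.rnDeriv volume x).toReal) : ℝ≥0∞) : EReal)
  else ⊥

/-- Mutual information `I(X; X̂)` (in nats) of the pair with `X ∼ μ` and conditional law `κ` of `X̂`
given `X`: the relative entropy of the joint law with respect to the product of the marginals. -/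
def mutualInfo (μ : Measure ℝ) (κ : Kernel ℝ ℝ) : ℝ≥0∞ :=
  InformationTheory.klDiv (μ ⊗ₘ κ) (μ.prod (κ ∘ₘ μ))

/-- Rate-distortion function of the source law `μ` at distortion `d`, under `r`-th moment
distortion: the infimum of `I(X; X̂)` over all transition probability kernels with
`E|X - X̂|^r ≤ d`. -/
def rateDistortion (r : ℝ) (μ : Measure ℝ) (d : ℝ) : ℝ≥0∞ :=
  ⨅ (κ : Kernel ℝ ℝ) (_ : IsMarkovKernel κ)
    (_ : ∫⁻ p, ENNReal.ofReal (|p.1 - p.2| ^ r) ∂(μ ⊗ₘ κ) ≤ ENNReal.ofReal d),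
    mutualInfo μ κ

/-- Shannon lower bound `h(X) - log (α_r d^{1/r})`, with `log 0 = -∞`. -/
def shannonLowerBound (r : ℝ) (μ : Measure ℝ) (d : ℝ) : EReal :=
  diffEntropy μ - ENNReal.log (ENNReal.ofReal (rdAlpha r * d ^ (1 / r)))

open scoped Classical in
/-- `D(X ‖ G_X)`, where `G_X ∼ N(0, ‖X‖₂²)`; it is `+∞` if `‖X‖₂ = ∞`. -/
def relEntropyGaussian {Ω : Type*} [MeasurableSpace Ω] (P : Measure Ω) (X : Ω → ℝ) : ℝ≥0∞ :=
  if eLpNorm X 2 P = ⊤ then ⊤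
  else InformationTheory.klDiv (P.map X) (gaussianReal 0 ((eLpNorm X 2 P).toNNReal ^ 2))

end

/-! The rate is bounded above by test channels `Y = aX + Z`, with `Z` independent of `X` and
centred. Replacing the law of `Y` by a Gaussian with the same second moment `s` only increases the
divergence (`mutualInfo_le_klDiv_prod`), so `I(X;Y) ≤ log √(2πe s) - h(Z)`
(`mutualInfo_additiveNoise_le`). The noise is exponential power with `E|Z|^p = t^p`, for which `h(Z)
= log(α_p t)` and `E Z² = t²(β_p² - 1)`. Write `σ = ‖X‖₂` and `τ = d^{1/r}`. For `r ≤ 2` and `σ >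
τ`, the optimal Gaussian channel for squared error has mean square distortion `τ²`, hence is
admissible since `‖·‖_r ≤ ‖·‖₂`; its rate is at most `log(σ/τ)`. For `r > 2`, take `a = 1`, `p = r`,
`t = τ`: with `b = max(σ, τ)` the second moment of `Y` is at most `β_r² b²`. Both rates have the
form `log(cσ/(α_r τ))` when `σ ≥ τ`. Since `D(X‖G_X) = log √(2πe σ²) - h(X)`
(`exists_diffEntropy_eq`), subtracting the Shannon lower bound leaves `D(X‖G_X) + log(c/√(2πe))`.
The zero-rate cases use the reproduction 0. -/

/-! ### Divergence bounds for mutual information. -/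

open InformationTheory in
/-- Replacing the output law by any other reference law can only increase the divergence that
defines mutual information. -/
lemma mutualInfo_le_klDiv_prod (μ Q : Measure ℝ) (κ : Kernel ℝ ℝ) [IsProbabilityMeasure μ]
    [IsProbabilityMeasure Q] [IsMarkovKernel κ] :
    mutualInfo μ κ ≤ klDiv (μ ⊗ₘ κ) (μ.prod Q) := by
  -- Disintegrating along the output puts its law in the first coordinate, where the chain rule
  -- splits off the nonnegative term `D(κ ∘ₘ μ ‖ Q)`.
  have hswap : μ ⊗ₘ κ = ((κ ∘ₘ μ) ⊗ₘ (κ†μ)).map Prod.swap := by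
    rw [compProd_posterior_eq_map_swap, Measure.map_map measurable_swap measurable_swap]
    simp
  calc mutualInfo μ κ
      = klDiv (((κ ∘ₘ μ) ⊗ₘ (κ†μ)).map Prod.swap) (((κ ∘ₘ μ).prod μ).map Prod.swap) := by
        rw [mutualInfo, ← hswap, Measure.prod_swap]
    _ ≤ klDiv ((κ ∘ₘ μ) ⊗ₘ (κ†μ)) ((κ ∘ₘ μ) ⊗ₘ Kernel.const ℝ μ) := by
        rw [Measure.compProd_const]
        exact klDiv_map_le _ _ measurable_swap
    _ ≤ klDiv ((κ ∘ₘ μ) ⊗ₘ (κ†μ)) (Q ⊗ₘ Kernel.const ℝ μ) := by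
        rw [klDiv_compProd_eq_add (κ ∘ₘ μ) Q]
        exact le_add_self
    _ = klDiv ((μ ⊗ₘ κ).map Prod.swap) ((μ.prod Q).map Prod.swap) := by
        rw [Measure.compProd_const, compProd_posterior_eq_map_swap, Measure.prod_swap]
    _ ≤ klDiv (μ ⊗ₘ κ) (μ.prod Q) := klDiv_map_le _ _ measurable_swap

-- Nonnegativity is recorded because `ENNReal.ofReal` truncates; it is needed to return to a bound
-- in `EReal`.
open InformationTheory in
lemma klDiv_withDensity_ofReal {α : Type*} [MeasurableSpace α] {ρ J : Measure α}
    [IsProbabilityMeasure ρ] [IsProbabilityMeasure J] {f : α → ℝ} (hf : Measurable f)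
    (hpos : ∀ x, 0 < f x) (hJ : J = ρ.withDensity fun x ↦ ENNReal.ofReal (f x))
    (hint : Integrable (fun x ↦ Real.log (f x)) J) :
    0 ≤ ∫ x, Real.log (f x) ∂J ∧ klDiv J ρ = ENNReal.ofReal (∫ x, Real.log (f x) ∂J) := by
  have hac : J ≪ ρ := hJ ▸ withDensity_absolutelyContinuous _ _
  have hllr : llr J ρ =ᵐ[J] fun x ↦ Real.log (f x) := by
    refine hac.ae_le ?_
    have h := Measure.rnDeriv_withDensity ρ hf.ennreal_ofReal
    rw [← hJ] at h
    filter_upwards [h] with x hx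
    rw [llr, hx, ENNReal.toReal_ofReal (hpos x).le]
  have hi : Integrable (llr J ρ) J := hint.congr hllr.symm
  have h0 := integral_llr_add_sub_measure_univ_nonneg hac hi
  rw [klDiv_of_ac_of_integrable hac hi]
  simp only [probReal_univ, add_sub_cancel_right, integral_congr_ae hllr] at h0 ⊢
  exact ⟨h0, trivial⟩

/-! ### Additive noise channels. -/

/-- The channel `x ↦ a x + Z` with noise `Z ∼ ν`. -/
noncomputable def additiveNoise (a : ℝ) (ν : Measure ℝ) [SFinite ν] : Kernel ℝ ℝ :=
  (Kernel.id ×ₖ Kernel.const ℝ ν).map fun p ↦ a * p.1 + p.2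

instance (a : ℝ) (ν : Measure ℝ) [IsProbabilityMeasure ν] : IsMarkovKernel (additiveNoise a ν) :=
  Kernel.IsMarkovKernel.map _ (by fun_prop)

lemma lintegral_additiveNoise (a x : ℝ) (ν : Measure ℝ) [IsProbabilityMeasure ν] {F : ℝ → ℝ≥0∞}
    (hF : Measurable F) : ∫⁻ y, F y ∂(additiveNoise a ν x) = ∫⁻ z, F (a * x + z) ∂ν := by
  rw [additiveNoise, Kernel.lintegral_map _ (by fun_prop) _ hF,
    Kernel.lintegral_id_prod (by fun_prop)]
  rfl

lemma lintegral_compProd_additiveNoise (a : ℝ) (μ ν : Measure ℝ) [IsProbabilityMeasure μ]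
    [IsProbabilityMeasure ν] {F : ℝ × ℝ → ℝ≥0∞} (hF : Measurable F) :
    ∫⁻ p, F p ∂(μ ⊗ₘ additiveNoise a ν) = ∫⁻ x, ∫⁻ z, F (x, a * x + z) ∂ν ∂μ := by
  rw [Measure.lintegral_compProd hF]
  refine lintegral_congr fun x ↦ ?_
  rw [lintegral_additiveNoise a x ν (F := fun y ↦ F (x, y)) (by fun_prop)]

lemma compProd_additiveNoise_eq_map (a : ℝ) (μ ν : Measure ℝ) [IsProbabilityMeasure μ]
    [IsProbabilityMeasure ν] :
    μ ⊗ₘ additiveNoise a ν = (μ.prod ν).map fun p ↦ (p.1, a * p.1 + p.2) := by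
  refine Measure.ext_of_lintegral _ fun F hF ↦ ?_
  rw [lintegral_compProd_additiveNoise a μ ν hF, lintegral_map hF (by fun_prop),
    lintegral_prod _ (by fun_prop)]

/-- Given `X = x`, the output has density `g(y - ax)`, so only the noise and the reference law need
densities; `μ` is arbitrary. -/
lemma compProd_additiveNoise_eq_withDensity (a : ℝ) (μ ν Q : Measure ℝ) [IsProbabilityMeasure μ]
    [IsProbabilityMeasure ν] [IsProbabilityMeasure Q] {g q : ℝ → ℝ} (hg : Measurable g)
    (hq : Measurable q) (hqpos : ∀ x, 0 < q x)
    (hν : ν = volume.withDensity fun x ↦ ENNReal.ofReal (g x))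
    (hQ : Q = volume.withDensity fun x ↦ ENNReal.ofReal (q x)) :
    μ ⊗ₘ additiveNoise a ν
      = (μ.prod Q).withDensity fun p ↦ ENNReal.ofReal (g (p.2 - a * p.1) / q p.2) := by
  refine Measure.ext_of_lintegral _ fun F hF ↦ ?_
  rw [lintegral_compProd_additiveNoise a μ ν hF,
    lintegral_withDensity_eq_lintegral_mul _ (by fun_prop) hF, lintegral_prod _ (by fun_prop)]
  refine lintegral_congr fun x ↦ ?_
  rw [hν, hQ, lintegral_withDensity_eq_lintegral_mul _ (by fun_prop) (by fun_prop),
    lintegral_withDensity_eq_lintegral_mul _ (by fun_prop) (by fun_prop),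
    ← lintegral_sub_right_eq_self _ (a * x)]
  refine lintegral_congr fun y ↦ ?_
  simp only [Pi.mul_apply, add_sub_cancel]
  rw [← mul_assoc, ← ENNReal.ofReal_mul (hqpos y).le, mul_div_cancel₀ _ (hqpos y).ne']

/-- Maximum entropy bound for the information rate of an additive noise channel. -/
lemma mutualInfo_additiveNoise_le (a : ℝ) (μ ν : Measure ℝ) [IsProbabilityMeasure μ]
    [IsProbabilityMeasure ν] {g : ℝ → ℝ} (hg : Measurable g) (hgpos : ∀ x, 0 < g x)
    (hν : ν = volume.withDensity fun x ↦ ENNReal.ofReal (g x))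
    (hlog : Integrable (fun z ↦ Real.log (g z)) ν)
    (hμ : MemLp id 2 μ) (hν2 : MemLp id 2 ν) (hmean : ∫ z, z ∂ν = 0) {s : ℝ}
    (hs : s = a ^ 2 * ∫ x, x ^ 2 ∂μ + ∫ z, z ^ 2 ∂ν) (hspos : 0 < s) :
    0 ≤ ∫ z, Real.log (g z) ∂ν + Real.log (Real.sqrt (2 * Real.pi * Real.exp 1 * s)) ∧
    mutualInfo μ (additiveNoise a ν) ≤ ENNReal.ofReal
      (∫ z, Real.log (g z) ∂ν + Real.log (Real.sqrt (2 * Real.pi * Real.exp 1 * s))) := by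
  obtain ⟨v, hvs⟩ : ∃ v : ℝ≥0, (v : ℝ) = s := ⟨⟨s, hspos.le⟩, rfl⟩
  have hv0 : v ≠ 0 := by rintro rfl; exact hspos.ne hvs
  set T : ℝ × ℝ → ℝ × ℝ := fun p ↦ (p.1, a * p.1 + p.2) with hT
  have hTm : Measurable T := by fun_prop
  -- In the coordinates `(x, z)` the numerator is `g z` and minus the log of the Gaussian density is
  -- quadratic.
  have hlogf : ∀ p : ℝ × ℝ, Real.log (g ((T p).2 - a * (T p).1) / gaussianPDFReal 0 v (T p).2)
      = Real.log (g p.2) + (Real.log (Real.sqrt (2 * Real.pi * s))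
        + (a ^ 2 * p.1 ^ 2 + 2 * a * (p.1 * p.2) + p.2 ^ 2) / (2 * s)) := by
    intro p
    have hsq : 0 < Real.sqrt (2 * Real.pi * s) := by positivity
    rw [Real.log_div (hgpos _).ne' (gaussianPDFReal_pos _ _ _ hv0).ne', gaussianPDFReal,
      Real.log_mul (by rw [hvs]; exact (inv_pos.2 hsq).ne') (Real.exp_pos _).ne', Real.log_inv, Real.log_exp]
    simp only [hT, hvs, add_sub_cancel_left, sub_zero]
    ring
  have hμi : Integrable (fun x : ℝ ↦ x) μ := hμ.integrable (by norm_num)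
  have hνi : Integrable (fun x : ℝ ↦ x) ν := hν2.integrable (by norm_num)
  have hμ2 : Integrable (fun x : ℝ ↦ x ^ 2) μ := hμ.integrable_sq
  have hν22 : Integrable (fun x : ℝ ↦ x ^ 2) ν := hν2.integrable_sq
  have i1 : Integrable (fun p : ℝ × ℝ ↦ Real.log (g p.2)) (μ.prod ν) := hlog.comp_snd μ
  have i2 : Integrable (fun p : ℝ × ℝ ↦ a ^ 2 * p.1 ^ 2) (μ.prod ν) :=
    (hμ2.comp_fst ν).const_mul _
  have i3 : Integrable (fun p : ℝ × ℝ ↦ 2 * a * (p.1 * p.2)) (μ.prod ν) :=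
    (hμi.mul_prod hνi).const_mul _
  have i4 : Integrable (fun p : ℝ × ℝ ↦ p.2 ^ 2) (μ.prod ν) := hν22.comp_snd μ
  have i5 : Integrable (fun p : ℝ × ℝ ↦ Real.log (Real.sqrt (2 * Real.pi * s))
      + (a ^ 2 * p.1 ^ 2 + 2 * a * (p.1 * p.2) + p.2 ^ 2) / (2 * s)) (μ.prod ν) :=
    (integrable_const _).add (((i2.add i3).add i4).div_const _)
  have hJ := compProd_additiveNoise_eq_map a μ ν
  have hfm : Measurable fun p : ℝ × ℝ ↦ g (p.2 - a * p.1) / gaussianPDFReal 0 v p.2 := by fun_prop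
  have hint : Integrable (fun p : ℝ × ℝ ↦ Real.log (g (p.2 - a * p.1) / gaussianPDFReal 0 v p.2))
      (μ ⊗ₘ additiveNoise a ν) := by
    rw [hJ, integrable_map_measure hfm.log.aestronglyMeasurable hTm.aemeasurable]
    refine Integrable.congr ?_ (ae_of_all _ fun p ↦ (hlogf p).symm)
    exact i1.add i5
  have hval : ∫ p, Real.log (g (p.2 - a * p.1) / gaussianPDFReal 0 v p.2)
      ∂(μ ⊗ₘ additiveNoise a ν)
      = ∫ z, Real.log (g z) ∂ν + Real.log (Real.sqrt (2 * Real.pi * Real.exp 1 * s)) := by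
    rw [hJ, integral_map hTm.aemeasurable hfm.log.aestronglyMeasurable]
    simp only [hlogf]
    have e : ∫ p : ℝ × ℝ, (Real.log (Real.sqrt (2 * Real.pi * s))
        + (a ^ 2 * p.1 ^ 2 + 2 * a * (p.1 * p.2) + p.2 ^ 2) / (2 * s)) ∂(μ.prod ν)
        = ∫ _ : ℝ × ℝ, Real.log (Real.sqrt (2 * Real.pi * s)) ∂(μ.prod ν)
          + ∫ p : ℝ × ℝ, (a ^ 2 * p.1 ^ 2 + 2 * a * (p.1 * p.2) + p.2 ^ 2) / (2 * s) ∂(μ.prod ν) :=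
      integral_add (integrable_const _) (((i2.add i3).add i4).div_const _)
    have e' : ∫ p : ℝ × ℝ, (a ^ 2 * p.1 ^ 2 + 2 * a * (p.1 * p.2) + p.2 ^ 2) ∂(μ.prod ν)
        = ∫ p : ℝ × ℝ, (a ^ 2 * p.1 ^ 2 + 2 * a * (p.1 * p.2)) ∂(μ.prod ν)
          + ∫ p : ℝ × ℝ, p.2 ^ 2 ∂(μ.prod ν) := integral_add (i2.add i3) i4
    -- The cross term vanishes because the noise is independent and centred; `X` need not be. The
    -- quadratic part integrates to `s / (2s) = 1/2`, the source of the factor `e` in `2πe s`.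
    rw [integral_add i1 i5, e, integral_div, e', integral_add i2 i3, integral_const_mul, integral_const_mul,
      integral_prod_mul (fun x : ℝ ↦ x) (fun x : ℝ ↦ x), hmean,
      integral_fun_fst (fun x : ℝ ↦ x ^ 2), integral_fun_snd (fun x : ℝ ↦ x ^ 2),
      integral_fun_snd (fun x : ℝ ↦ Real.log (g x))]
    simp only [probReal_univ, one_smul, mul_zero, add_zero, integral_const]
    rw [← hs, Real.log_sqrt (by positivity), Real.log_sqrt (by positivity),
      show 2 * Real.pi * Real.exp 1 * s = 2 * Real.pi * s * Real.exp 1 by ring,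
      Real.log_mul (x := 2 * Real.pi * s) (by positivity) (by positivity), Real.log_exp]
    field_simp
  obtain ⟨h0, h1⟩ := klDiv_withDensity_ofReal hfm
    (fun p ↦ div_pos (hgpos _) (gaussianPDFReal_pos 0 v _ hv0))
    (compProd_additiveNoise_eq_withDensity a μ ν (gaussianReal 0 v) hg
      (measurable_gaussianPDFReal 0 v) (fun x ↦ gaussianPDFReal_pos 0 v x hv0) hν
      (gaussianReal_of_var_ne_zero 0 hv0)) hint
  rw [hval] at h0 h1
  exact ⟨h0, h1 ▸ mutualInfo_le_klDiv_prod μ (gaussianReal 0 v) _⟩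

/-! ### Moments and entropy of exponential power laws. -/

lemma integrable_comp_abs_of_integrableOn_Ioi {f : ℝ → ℝ} (hf : IntegrableOn f (Set.Ioi 0)) :
    Integrable fun x ↦ f |x| := by
  have h1 : IntegrableOn (fun x ↦ f |x|) (Set.Ioi 0) :=
    hf.congr_fun (fun x hx ↦ by rw [abs_of_pos hx]) measurableSet_Ioi
  have h2 : IntegrableOn (fun x ↦ f |x|) (Set.Iic 0) := by
    rw [← Measure.map_neg_eq_self (volume : Measure ℝ)]
    let m : MeasurableEmbedding fun x : ℝ => -x := (Homeomorph.neg ℝ).measurableEmbedding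
    rw [m.integrableOn_map_iff]
    simp_rw [Function.comp_def, abs_neg, Set.neg_preimage, Set.neg_Iic, neg_zero]
    exact Iff.mpr integrableOn_Ici_iff_integrableOn_Ioi h1
  rw [← integrableOn_univ, ← Set.Iic_union_Ioi (a := (0 : ℝ))]
  exact h2.union h1

lemma integrable_abs_rpow_mul_exp {p q b : ℝ} (hp : 0 < p) (hq : -1 < q) (hb : 0 < b) :
    Integrable fun x : ℝ ↦ |x| ^ q * Real.exp (-b * |x| ^ p) :=
  integrable_comp_abs_of_integrableOn_Ioi (f := fun x ↦ x ^ q * Real.exp (-b * x ^ p))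
    (integrableOn_rpow_mul_exp_neg_mul_rpow hq hp hb)

lemma integral_abs_rpow_mul_exp {p q b : ℝ} (hp : 0 < p) (hq : -1 < q) (hb : 0 < b) :
    ∫ x : ℝ, |x| ^ q * Real.exp (-b * |x| ^ p)
      = 2 * (b ^ (-(q + 1) / p) * (1 / p) * Real.Gamma ((q + 1) / p)) := by
  rw [integral_comp_abs (f := fun x ↦ x ^ q * Real.exp (-b * x ^ p)),
    integral_rpow_mul_exp_neg_mul_rpow hp hq hb]

/-- Density of the exponential power law with `E|Z|^p = t^p`. -/
noncomputable def expPowerPDF (p t z : ℝ) : ℝ :=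
  (2 * Real.Gamma (1 + 1 / p) * p ^ (1 / p) * t)⁻¹ * Real.exp (-(p * t ^ p)⁻¹ * |z| ^ p)

/-- The exponential power law with `E|Z|^p = t^p`. -/
noncomputable def expPower (p t : ℝ) : Measure ℝ :=
  volume.withDensity fun z ↦ ENNReal.ofReal (expPowerPDF p t z)

lemma measurable_expPowerPDF (p t : ℝ) : Measurable (expPowerPDF p t) := by
  unfold expPowerPDF
  fun_prop

variable {p t : ℝ}

lemma expPowerPDF_const_pos (hp : 0 < p) (ht : 0 < t) :
    0 < 2 * Real.Gamma (1 + 1 / p) * p ^ (1 / p) * t := by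
  have : 0 < Real.Gamma (1 + 1 / p) := Real.Gamma_pos_of_pos (by positivity)
  positivity

lemma expPowerPDF_pos (hp : 0 < p) (ht : 0 < t) (z : ℝ) : 0 < expPowerPDF p t z := by
  have := expPowerPDF_const_pos hp ht
  unfold expPowerPDF
  positivity

lemma inv_mul_rpow_rpow (hp : 0 < p) (ht : 0 < t) (c : ℝ) :
    ((p * t ^ p)⁻¹) ^ (-c / p) = p ^ (c / p) * t ^ c := by
  have htp : 0 < t ^ p := by positivity
  rw [neg_div, Real.rpow_neg (by positivity), Real.inv_rpow (by positivity), inv_inv,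
    Real.mul_rpow hp.le htp.le, ← Real.rpow_mul ht.le, mul_div_cancel₀ _ hp.ne']

/-- A Gamma integral serving three exponents: `q = 0` normalises, `q = p` gives `t ^ p`, and `q = 2`
gives the second moment. -/
lemma integral_abs_rpow_mul_expPowerPDF (hp : 0 < p) (ht : 0 < t) {q : ℝ} (hq : -1 < q) :
    ∫ z, |z| ^ q * expPowerPDF p t z
      = p ^ (q / p) * t ^ q * (Real.Gamma ((q + 1) / p) / Real.Gamma (1 / p)) := by
  have hb : 0 < (p * t ^ p)⁻¹ := by positivity
  have hG : 0 < Real.Gamma (1 / p) := Real.Gamma_pos_of_pos (by positivity)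
  have hG1 : Real.Gamma (1 + 1 / p) = 1 / p * Real.Gamma (1 / p) := by
    rw [add_comm, Real.Gamma_add_one (by positivity)]
  have e : ∀ z : ℝ, |z| ^ q * expPowerPDF p t z
      = (2 * Real.Gamma (1 + 1 / p) * p ^ (1 / p) * t)⁻¹
        * (|z| ^ q * Real.exp (-(p * t ^ p)⁻¹ * |z| ^ p)) := fun z ↦ by
    unfold expPowerPDF; ring
  simp only [e]
  rw [integral_const_mul, integral_abs_rpow_mul_exp hp hq hb, inv_mul_rpow_rpow hp ht, hG1,
    Real.rpow_add_one ht.ne', add_div, Real.rpow_add hp]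
  have : 0 < p ^ (1 / p) := by positivity
  field_simp

lemma integrable_abs_rpow_mul_expPowerPDF (hp : 0 < p) (ht : 0 < t) {q : ℝ} (hq : -1 < q) :
    Integrable fun z ↦ |z| ^ q * expPowerPDF p t z := by
  have hb : 0 < (p * t ^ p)⁻¹ := by positivity
  refine ((integrable_abs_rpow_mul_exp hp hq hb).const_mul
    (2 * Real.Gamma (1 + 1 / p) * p ^ (1 / p) * t)⁻¹).congr (ae_of_all _ fun z ↦ ?_)
  simp only [expPowerPDF]
  ring

lemma isProbabilityMeasure_expPower (hp : 0 < p) (ht : 0 < t) :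
    IsProbabilityMeasure (expPower p t) := by
  have hi := integrable_abs_rpow_mul_expPowerPDF hp ht (q := 0) (by norm_num)
  have he := integral_abs_rpow_mul_expPowerPDF hp ht (q := 0) (by norm_num)
  simp only [Real.rpow_zero, one_mul, zero_div, zero_add] at hi he
  rw [div_self (Real.Gamma_pos_of_pos (by positivity)).ne'] at he
  constructor
  rw [expPower, withDensity_apply _ MeasurableSet.univ, Measure.restrict_univ,
    ← ofReal_integral_eq_lintegral_ofReal hi (ae_of_all _ fun z ↦ (expPowerPDF_pos hp ht z).le), he,
    ENNReal.ofReal_one]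

lemma integrable_expPower_iff (hp : 0 < p) (ht : 0 < t) {f : ℝ → ℝ} :
    Integrable f (expPower p t) ↔ Integrable fun z ↦ f z * expPowerPDF p t z := by
  rw [expPower, integrable_withDensity_iff (measurable_expPowerPDF p t).ennreal_ofReal
    (ae_of_all _ fun _ ↦ ENNReal.ofReal_lt_top)]
  simp only [ENNReal.toReal_ofReal (expPowerPDF_pos hp ht _).le]

lemma integral_expPower (hp : 0 < p) (ht : 0 < t) (f : ℝ → ℝ) :
    ∫ z, f z ∂(expPower p t) = ∫ z, f z * expPowerPDF p t z := by
  rw [expPower, integral_withDensity_eq_integral_toReal_smul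
    (measurable_expPowerPDF p t).ennreal_ofReal (ae_of_all _ fun _ ↦ ENNReal.ofReal_lt_top)]
  simp only [ENNReal.toReal_ofReal (expPowerPDF_pos hp ht _).le, smul_eq_mul, mul_comm]

lemma integrable_abs_rpow_expPower (hp : 0 < p) (ht : 0 < t) {q : ℝ} (hq : -1 < q) :
    Integrable (fun z ↦ |z| ^ q) (expPower p t) :=
  (integrable_expPower_iff hp ht).2 (integrable_abs_rpow_mul_expPowerPDF hp ht hq)

lemma integral_abs_rpow_expPower (hp : 0 < p) (ht : 0 < t) {q : ℝ} (hq : -1 < q) :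
    ∫ z, |z| ^ q ∂(expPower p t)
      = p ^ (q / p) * t ^ q * (Real.Gamma ((q + 1) / p) / Real.Gamma (1 / p)) := by
  rw [integral_expPower hp ht, integral_abs_rpow_mul_expPowerPDF hp ht hq]

lemma integral_abs_rpow_self_expPower (hp : 0 < p) (ht : 0 < t) :
    ∫ z, |z| ^ p ∂(expPower p t) = t ^ p := by
  have hG : 0 < Real.Gamma (1 / p) := Real.Gamma_pos_of_pos (by positivity)
  rw [integral_abs_rpow_expPower hp ht (by linarith), div_self hp.ne', Real.rpow_one, add_div,
    div_self hp.ne', add_comm 1, Real.Gamma_add_one (by positivity)]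
  field_simp

lemma rdBeta_sq (hp : 0 < p) :
    rdBeta p ^ 2 = 1 + p ^ (2 / p) * Real.Gamma (3 / p) / Real.Gamma (1 / p) := by
  have h1 : 0 < Real.Gamma (1 / p) := Real.Gamma_pos_of_pos (by positivity)
  have h3 : 0 < Real.Gamma (3 / p) := Real.Gamma_pos_of_pos (by positivity)
  exact Real.sq_sqrt (by positivity)

lemma one_lt_rdBeta (hp : 0 < p) : 1 < rdBeta p := by
  have h1 : 0 < Real.Gamma (1 / p) := Real.Gamma_pos_of_pos (by positivity)
  have h3 : 0 < Real.Gamma (3 / p) := Real.Gamma_pos_of_pos (by positivity)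
  rw [rdBeta, Real.lt_sqrt (by norm_num)]
  have : 0 < p ^ (2 / p) * Real.Gamma (3 / p) / Real.Gamma (1 / p) := by positivity
  linarith

lemma rdAlpha_pos (hp : 0 < p) : 0 < rdAlpha p := by
  have : 0 < Real.Gamma (1 + 1 / p) := Real.Gamma_pos_of_pos (by positivity)
  unfold rdAlpha
  positivity

/-- This is the origin of `β`: adding noise with `t = 1` to an independent signal of unit second
moment gives second moment `β²`. -/
lemma integral_sq_expPower (hp : 0 < p) (ht : 0 < t) :
    ∫ z, z ^ 2 ∂(expPower p t) = t ^ 2 * (rdBeta p ^ 2 - 1) := by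
  have h := integral_abs_rpow_expPower hp ht (q := 2) (by norm_num)
  simp only [Real.rpow_ofNat, sq_abs] at h
  rw [h, rdBeta_sq hp]
  norm_num
  ring

lemma memLp_two_expPower (hp : 0 < p) (ht : 0 < t) : MemLp id 2 (expPower p t) := by
  rw [memLp_two_iff_integrable_sq measurable_id.aestronglyMeasurable]
  have h := integrable_abs_rpow_expPower hp ht (q := 2) (by norm_num)
  simpa only [Real.rpow_ofNat, sq_abs, id_eq] using h

lemma integral_id_expPower (hp : 0 < p) (ht : 0 < t) : ∫ z, z ∂(expPower p t) = 0 := by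
  rw [integral_expPower hp ht fun z ↦ z]
  have h := integral_neg_eq_self (fun z ↦ z * expPowerPDF p t z) (volume : Measure ℝ)
  have e : ∀ z, -z * expPowerPDF p t (-z) = -(z * expPowerPDF p t z) := fun z ↦ by
    simp [expPowerPDF]
  simp only [e, integral_neg] at h
  linarith

lemma log_expPowerPDF (hp : 0 < p) (ht : 0 < t) (z : ℝ) :
    Real.log (expPowerPDF p t z)
      = -(p * t ^ p)⁻¹ * |z| ^ p - Real.log (2 * Real.Gamma (1 + 1 / p) * p ^ (1 / p) * t) := by
  rw [expPowerPDF, Real.log_mul (inv_pos.2 (expPowerPDF_const_pos hp ht)).ne' (Real.exp_pos _).ne',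
    Real.log_inv, Real.log_exp]
  ring

lemma integrable_log_expPowerPDF (hp : 0 < p) (ht : 0 < t) :
    Integrable (fun z ↦ Real.log (expPowerPDF p t z)) (expPower p t) := by
  have := isProbabilityMeasure_expPower hp ht
  simp only [log_expPowerPDF hp ht]
  exact ((integrable_abs_rpow_expPower hp ht (by linarith)).const_mul _).sub (integrable_const _)

/-- Since `E|Z|^p = t^p`, the exponent contributes exactly `-1/p`, whence the factor `e^{1/p}` in
`α_p`. -/
lemma integral_log_expPowerPDF (hp : 0 < p) (ht : 0 < t) :
    ∫ z, Real.log (expPowerPDF p t z) ∂(expPower p t) = -Real.log (rdAlpha p * t) := by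
  have := isProbabilityMeasure_expPower hp ht
  simp only [log_expPowerPDF hp ht]
  rw [integral_sub ((integrable_abs_rpow_expPower hp ht (by linarith)).const_mul _)
    (integrable_const _), integral_const_mul, integral_abs_rpow_self_expPower hp ht,
    integral_const, probReal_univ, one_smul,
    show rdAlpha p * t = Real.exp (1 / p) * (2 * Real.Gamma (1 + 1 / p) * p ^ (1 / p) * t) by
      unfold rdAlpha; ring,
    Real.log_mul (Real.exp_pos _).ne' (expPowerPDF_const_pos hp ht).ne', Real.log_exp]
  have : 0 < t ^ p := by positivity
  field_simp
  ring

/-- For `p = 2` the exponential power law is `N(0, t²)`, so Gaussian noise needs no separate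
treatment. -/
lemma rdAlpha_two : rdAlpha 2 = Real.sqrt (2 * Real.pi * Real.exp 1) := by
  have e : Real.Gamma (1 + 1 / 2) = 1 / 2 * Real.sqrt Real.pi := by
    rw [add_comm, Real.Gamma_add_one (by norm_num), Real.Gamma_one_half_eq]
  rw [rdAlpha, e, Real.sqrt_mul (by positivity), Real.sqrt_mul (by norm_num),
    Real.sqrt_eq_rpow (Real.exp 1), ← Real.exp_mul, Real.sqrt_eq_rpow 2]
  norm_num
  ring

lemma rdBeta_two_sq : rdBeta 2 ^ 2 = 2 := by
  rw [rdBeta_sq two_pos, show (3 : ℝ) / 2 = 1 / 2 + 1 by norm_num,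
    Real.Gamma_add_one (by norm_num), Real.Gamma_one_half_eq]
  have : 0 < Real.sqrt Real.pi := by positivity
  norm_num
  field_simp
  norm_num

/-- Rate of the channel `Y = a X + Z` with exponential power noise. -/
lemma mutualInfo_expPower_le (hp : 0 < p) (ht : 0 < t) (a : ℝ) (μ : Measure ℝ)
    [IsProbabilityMeasure μ] [IsProbabilityMeasure (expPower p t)] (hμ : MemLp id 2 μ) {b : ℝ}
    (hb : Real.sqrt (a ^ 2 * ∫ x, x ^ 2 ∂μ + t ^ 2 * (rdBeta p ^ 2 - 1)) ≤ b) :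
    0 ≤ Real.log (Real.sqrt (2 * Real.pi * Real.exp 1) * b / (rdAlpha p * t)) ∧
    mutualInfo μ (additiveNoise a (expPower p t))
      ≤ ENNReal.ofReal (Real.log (Real.sqrt (2 * Real.pi * Real.exp 1) * b / (rdAlpha p * t))) := by
  have hβ := one_lt_rdBeta hp
  have hα := rdAlpha_pos hp
  have hs : 0 < a ^ 2 * ∫ x, x ^ 2 ∂μ + t ^ 2 * (rdBeta p ^ 2 - 1) := by
    have h1 : 0 ≤ ∫ x, x ^ 2 ∂μ := integral_nonneg fun x ↦ sq_nonneg x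
    have h2 : 0 < rdBeta p ^ 2 - 1 := by nlinarith
    positivity
  obtain ⟨h0, h1⟩ := mutualInfo_additiveNoise_le a μ (expPower p t) (measurable_expPowerPDF p t)
    (expPowerPDF_pos hp ht) rfl (integrable_log_expPowerPDF hp ht) hμ (memLp_two_expPower hp ht)
    (integral_id_expPower hp ht) (by rw [integral_sq_expPower hp ht]) hs
  have hle : ∫ z, Real.log (expPowerPDF p t z) ∂(expPower p t) + Real.log (Real.sqrt
      (2 * Real.pi * Real.exp 1 * (a ^ 2 * ∫ x, x ^ 2 ∂μ + t ^ 2 * (rdBeta p ^ 2 - 1))))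
      ≤ Real.log (Real.sqrt (2 * Real.pi * Real.exp 1) * b / (rdAlpha p * t)) := by
    have hsq := Real.sqrt_pos.2 hs
    have hb0 : 0 < b := hsq.trans_le hb
    rw [integral_log_expPowerPDF hp ht, Real.log_div (by positivity) (by positivity),
      Real.sqrt_mul (by positivity), neg_add_eq_sub]
    gcongr
  exact ⟨h0.trans hle, h1.trans (ENNReal.ofReal_le_ofReal hle)⟩

/-! ### Distortion constraints and achievable rates. -/

lemma lintegral_ofReal_abs_rpow {α : Type*} [MeasurableSpace α] {P : Measure α} {f : α → ℝ}
    {q : ℝ} (hq : 0 < q) :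
    ∫⁻ x, ENNReal.ofReal (|f x| ^ q) ∂P = eLpNorm f (ENNReal.ofReal q) P ^ q := by
  rw [eLpNorm_eq_lintegral_rpow_enorm_toReal (by simpa using hq) ENNReal.ofReal_ne_top,
    ENNReal.toReal_ofReal hq.le, one_div, ENNReal.rpow_inv_rpow hq.ne']
  refine lintegral_congr fun x ↦ ?_
  rw [← ENNReal.ofReal_rpow_of_nonneg (abs_nonneg _) hq.le, ← Real.norm_eq_abs,
    ofReal_norm]

lemma lintegral_ofReal_abs_rpow_le_iff {α : Type*} [MeasurableSpace α] {P : Measure α}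
    {f : α → ℝ} {q c : ℝ} (hq : 0 < q) (hc : 0 ≤ c) :
    ∫⁻ x, ENNReal.ofReal (|f x| ^ q) ∂P ≤ ENNReal.ofReal (c ^ q)
      ↔ eLpNorm f (ENNReal.ofReal q) P ≤ ENNReal.ofReal c := by
  rw [lintegral_ofReal_abs_rpow hq, ← ENNReal.ofReal_rpow_of_nonneg hc hq.le,
    ENNReal.rpow_le_rpow_iff hq]

lemma rateDistortion_le {r d : ℝ} {μ : Measure ℝ} (κ : Kernel ℝ ℝ) [hκ : IsMarkovKernel κ]
    (h : ∫⁻ p, ENNReal.ofReal (|p.1 - p.2| ^ r) ∂(μ ⊗ₘ κ) ≤ ENNReal.ofReal d) :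
    rateDistortion r μ d ≤ mutualInfo μ κ :=
  iInf_le_of_le κ (iInf_le_of_le hκ (iInf_le_of_le h le_rfl))

/-- A constant reproduction has rate zero. -/
lemma rateDistortion_eq_zero {r d : ℝ} (hr : 0 < r) (hd : 0 ≤ d) {μ : Measure ℝ}
    [IsProbabilityMeasure μ]
    (h : eLpNorm id (ENNReal.ofReal r) μ ≤ ENNReal.ofReal (d ^ (1 / r))) :
    rateDistortion r μ d = 0 := by
  refine le_antisymm ((rateDistortion_le (Kernel.const ℝ (Measure.dirac 0)) ?_).trans ?_) zero_le
  · rw [← lintegral_ofReal_abs_rpow_le_iff hr (by positivity), ← Real.rpow_mul hd,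
      one_div_mul_cancel hr.ne', Real.rpow_one] at h
    rw [Measure.lintegral_compProd (by fun_prop)]
    simpa using h
  · simp [mutualInfo, Measure.compProd_const]

lemma lintegral_distortion_one (r : ℝ) (μ ν : Measure ℝ) [IsProbabilityMeasure μ]
    [IsProbabilityMeasure ν] :
    ∫⁻ p, ENNReal.ofReal (|p.1 - p.2| ^ r) ∂(μ ⊗ₘ additiveNoise 1 ν)
      = ∫⁻ z, ENNReal.ofReal (|z| ^ r) ∂ν := by
  rw [lintegral_compProd_additiveNoise _ _ _ (by fun_prop)]
  simp

lemma lintegral_distortion_two (a : ℝ) (μ ν : Measure ℝ) [IsProbabilityMeasure μ]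
    [IsProbabilityMeasure ν] (hμ : MemLp id 2 μ) (hν : MemLp id 2 ν) (hmean : ∫ z, z ∂ν = 0) :
    ∫⁻ p, ENNReal.ofReal (|p.1 - p.2| ^ (2 : ℝ)) ∂(μ ⊗ₘ additiveNoise a ν)
      = ENNReal.ofReal ((1 - a) ^ 2 * ∫ x, x ^ 2 ∂μ + ∫ z, z ^ 2 ∂ν) := by
  have hμi : Integrable (fun x : ℝ ↦ x) μ := hμ.integrable (by norm_num)
  have hνi : Integrable (fun x : ℝ ↦ x) ν := hν.integrable (by norm_num)
  have hμ2 : Integrable (fun x : ℝ ↦ x ^ 2) μ := hμ.integrable_sq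
  have hν2 : Integrable (fun x : ℝ ↦ x ^ 2) ν := hν.integrable_sq
  have i2 : Integrable (fun p : ℝ × ℝ ↦ (1 - a) ^ 2 * p.1 ^ 2) (μ.prod ν) :=
    (hμ2.comp_fst ν).const_mul _
  have i3 : Integrable (fun p : ℝ × ℝ ↦ -2 * (1 - a) * (p.1 * p.2)) (μ.prod ν) :=
    (hμi.mul_prod hνi).const_mul _
  have i4 : Integrable (fun p : ℝ × ℝ ↦ p.2 ^ 2) (μ.prod ν) := hν2.comp_snd μ
  have e : ∀ p : ℝ × ℝ, |p.1 - (a * p.1 + p.2)| ^ (2 : ℝ)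
      = (1 - a) ^ 2 * p.1 ^ 2 + -2 * (1 - a) * (p.1 * p.2) + p.2 ^ 2 := fun p ↦ by
    rw [Real.rpow_ofNat, sq_abs]
    ring
  have i5 : Integrable (fun p : ℝ × ℝ ↦ |p.1 - (a * p.1 + p.2)| ^ (2 : ℝ)) (μ.prod ν) := by
    simp only [e]
    exact (i2.add i3).add i4
  have e' : ∫ p : ℝ × ℝ, ((1 - a) ^ 2 * p.1 ^ 2 + -2 * (1 - a) * (p.1 * p.2) + p.2 ^ 2) ∂(μ.prod ν)
      = ∫ p : ℝ × ℝ, ((1 - a) ^ 2 * p.1 ^ 2 + -2 * (1 - a) * (p.1 * p.2)) ∂(μ.prod ν)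
        + ∫ p : ℝ × ℝ, p.2 ^ 2 ∂(μ.prod ν) := integral_add (i2.add i3) i4
  rw [compProd_additiveNoise_eq_map, lintegral_map (by fun_prop) (by fun_prop),
    ← ofReal_integral_eq_lintegral_ofReal i5 (ae_of_all _ fun p ↦ by positivity)]
  simp only [e]
  rw [e', integral_add i2 i3, integral_const_mul, integral_const_mul,
    integral_prod_mul (fun x : ℝ ↦ x) (fun x : ℝ ↦ x), hmean,
    integral_fun_fst (fun x : ℝ ↦ x ^ 2), integral_fun_snd (fun x : ℝ ↦ x ^ 2)]
  simp

/-- Rate achieved by the Gaussian test channel when `r ≤ 2`. -/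
lemma rateDistortion_le_of_le_two {r d σ : ℝ} (hr : 1 ≤ r) (hr2 : r ≤ 2) (hd : 0 < d)
    {μ : Measure ℝ} [IsProbabilityMeasure μ] (hμ : MemLp id 2 μ) (hσ : ∫ x, x ^ 2 ∂μ = σ ^ 2)
    (hlt : d ^ (1 / r) < σ) :
    0 ≤ Real.log (rdAlpha r * σ / (rdAlpha r * d ^ (1 / r))) ∧
    rateDistortion r μ d
      ≤ ENNReal.ofReal (Real.log (rdAlpha r * σ / (rdAlpha r * d ^ (1 / r)))) := by
  have hr0 : 0 < r := by linarith
  set τ := d ^ (1 / r) with hτ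
  have hτ0 : 0 < τ := by positivity
  have hσ0 : 0 < σ := hτ0.trans hlt
  have hτr : τ ^ r = d := by
    rw [hτ, ← Real.rpow_mul hd.le, one_div_mul_cancel hr0.ne', Real.rpow_one]
  -- The channel has gain `w² = 1 - τ²/σ²` and noise deviation `τw`. Its output has second moment
  -- `w⁴σ² + τ²w² = (σw)²`, so `w` cancels in the rate.
  obtain ⟨w, hw0, hw⟩ : ∃ w : ℝ, 0 < w ∧ w ^ 2 = 1 - τ ^ 2 / σ ^ 2 := by
    have : τ ^ 2 / σ ^ 2 < 1 := by
      rw [div_lt_one (by positivity)]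
      gcongr
    exact ⟨Real.sqrt (1 - τ ^ 2 / σ ^ 2), Real.sqrt_pos.2 (by linarith),
      Real.sq_sqrt (by linarith)⟩
  have hτσ : τ ^ 2 = (1 - w ^ 2) * σ ^ 2 := by
    rw [hw]
    field_simp
    ring
  have hprob := isProbabilityMeasure_expPower two_pos (mul_pos hτ0 hw0)
  obtain ⟨h0, h1⟩ := mutualInfo_expPower_le two_pos (mul_pos hτ0 hw0) (w ^ 2) μ hμ (b := σ * w) (by
    rw [hσ, rdBeta_two_sq, show (w ^ 2) ^ 2 * σ ^ 2 + (τ * w) ^ 2 * (2 - 1) = (σ * w) ^ 2 by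
      rw [mul_pow τ w, hτσ]; ring]
    exact (Real.sqrt_sq (by positivity)).le)
  have hα : rdAlpha r ≠ 0 := (rdAlpha_pos hr0).ne'
  have hα2 : rdAlpha 2 ≠ 0 := (rdAlpha_pos two_pos).ne'
  -- The redundant factor `rdAlpha r` gives the bound the shape `cσ/(α_r τ)` with `c = α_r`.
  have e : Real.sqrt (2 * Real.pi * Real.exp 1) * (σ * w) / (rdAlpha 2 * (τ * w))
      = rdAlpha r * σ / (rdAlpha r * τ) := by
    rw [← rdAlpha_two]
    field_simp
  rw [e] at h0 h1
  refine ⟨h0, (rateDistortion_le _ ?_).trans h1⟩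
  rw [← hτr, lintegral_ofReal_abs_rpow_le_iff (f := fun p : ℝ × ℝ ↦ p.1 - p.2) hr0 hτ0.le]
  -- As `r ≤ 2`, it suffices to bound the mean square error, which is `(1 - w²)²σ² + τ²w² = τ²`.
  refine (eLpNorm_le_eLpNorm_of_exponent_le (ENNReal.ofReal_le_ofReal hr2)
    (by fun_prop)).trans ?_
  rw [← lintegral_ofReal_abs_rpow_le_iff two_pos hτ0.le, lintegral_distortion_two _ _ _ hμ
    (memLp_two_expPower two_pos (mul_pos hτ0 hw0)) (integral_id_expPower two_pos (mul_pos hτ0 hw0)),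
    integral_sq_expPower two_pos (mul_pos hτ0 hw0), hσ, rdBeta_two_sq]
  refine ENNReal.ofReal_le_ofReal (le_of_eq ?_)
  rw [Real.rpow_two, mul_pow τ w, hτσ]
  ring

/-- Rate achieved by additive exponential power noise. -/
lemma rateDistortion_le_of_max {r d σ b : ℝ} (hr : 1 ≤ r) (hd : 0 < d)
    {μ : Measure ℝ} [IsProbabilityMeasure μ] (hμ : MemLp id 2 μ) (hσ : ∫ x, x ^ 2 ∂μ = σ ^ 2)
    (hσ0 : 0 ≤ σ) (hσb : σ ≤ b) (hdb : d ^ (1 / r) ≤ b) :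
    0 ≤ Real.log (Real.sqrt (2 * Real.pi * Real.exp 1) * rdBeta r * b
      / (rdAlpha r * d ^ (1 / r))) ∧
    rateDistortion r μ d ≤ ENNReal.ofReal (Real.log
      (Real.sqrt (2 * Real.pi * Real.exp 1) * rdBeta r * b / (rdAlpha r * d ^ (1 / r)))) := by
  have hr0 : 0 < r := by linarith
  set τ := d ^ (1 / r) with hτ
  have hτ0 : 0 < τ := by positivity
  have hτr : τ ^ r = d := by
    rw [hτ, ← Real.rpow_mul hd.le, one_div_mul_cancel hr0.ne', Real.rpow_one]
  have hβ := one_lt_rdBeta hr0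
  have hprob := isProbabilityMeasure_expPower hr0 hτ0
  -- With unit gain the error is the noise itself, so `t = τ` spends the whole distortion budget.
  -- Since `b` dominates both `σ` and `τ`, `σ² + τ²(β² - 1) ≤ β²b²`.
  obtain ⟨h0, h1⟩ := mutualInfo_expPower_le hr0 hτ0 1 μ hμ (b := rdBeta r * b) (by
    rw [Real.sqrt_le_iff, hσ]
    have hb : 0 ≤ b := hσ0.trans hσb
    refine ⟨by positivity, ?_⟩
    have h1 : σ ^ 2 ≤ b ^ 2 := by gcongr
    have h2 : τ ^ 2 * (rdBeta r ^ 2 - 1) ≤ b ^ 2 * (rdBeta r ^ 2 - 1) := by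
      have : 0 ≤ rdBeta r ^ 2 - 1 := by nlinarith
      gcongr
    nlinarith)
  rw [← mul_assoc] at h0 h1
  refine ⟨h0, (rateDistortion_le _ ?_).trans h1⟩
  rw [lintegral_distortion_one, ← ofReal_integral_eq_lintegral_ofReal
    (integrable_abs_rpow_expPower hr0 hτ0 (by linarith)) (ae_of_all _ fun z ↦ by positivity),
    integral_abs_rpow_self_expPower hr0 hτ0, hτr]

/-! ### Entropy deficit and the gap to the Shannon lower bound. -/

/-- A law at finite divergence from a centred Gaussian with the same second moment has finite
differential entropy, and the divergence is the entropy deficit. -/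
lemma exists_diffEntropy_eq {μ : Measure ℝ} [IsProbabilityMeasure μ] {v : ℝ≥0} (hv : v ≠ 0)
    (hμ : MemLp id 2 μ) (hσ : ∫ x, x ^ 2 ∂μ = v)
    (hD : InformationTheory.klDiv μ (gaussianReal 0 v) ≠ ⊤) :
    ∃ h : ℝ, diffEntropy μ = h ∧ (InformationTheory.klDiv μ (gaussianReal 0 v)).toReal
      = Real.log (Real.sqrt (2 * Real.pi * Real.exp 1 * v)) - h := by
  obtain ⟨hac, hint⟩ := InformationTheory.klDiv_ne_top_iff.1 hD
  have hvol : μ ≪ volume := hac.trans (gaussianReal_absolutelyContinuous 0 hv)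
  have hv0 : (0 : ℝ) < v := by positivity
  have hllr : ∀ᵐ x ∂μ, Real.log (μ.rnDeriv volume x).toReal
      = llr μ (gaussianReal 0 v) x + -(Real.log (Real.sqrt (2 * Real.pi * v)) + x ^ 2 / (2 * v)) := by
    have h := Measure.rnDeriv_withDensity_right μ volume (f := gaussianPDF 0 v)
      (measurable_gaussianPDF 0 v).aemeasurable (ae_of_all _ fun x ↦ (gaussianPDF_pos 0 hv x).ne')
      (ae_of_all _ fun x ↦ gaussianPDF_ne_top)
    rw [← gaussianReal_of_var_ne_zero 0 hv] at h
    filter_upwards [hvol.ae_le h, hvol.ae_le (μ.rnDeriv_lt_top volume), Measure.rnDeriv_pos hvol]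
      with x hx hlt hpos
    have hsq : 0 < Real.sqrt (2 * Real.pi * v) := by positivity
    rw [llr, hx, ENNReal.toReal_mul, ENNReal.toReal_inv, toReal_gaussianPDF,
      Real.log_mul (inv_pos.2 (gaussianPDFReal_pos 0 v x hv)).ne'
        (ENNReal.toReal_pos hpos.ne' hlt.ne).ne', Real.log_inv, gaussianPDFReal,
      Real.log_mul (inv_pos.2 hsq).ne' (Real.exp_pos _).ne', Real.log_inv, Real.log_exp]
    ring
  have hquad : Integrable (fun x : ℝ ↦ Real.log (Real.sqrt (2 * Real.pi * v)) + x ^ 2 / (2 * v)) μ :=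
    (integrable_const _).add (hμ.integrable_sq.div_const _)
  -- Finite divergence and a finite second moment make `log f` integrable, which rules out `∞ - ∞`
  -- in the entropy.
  have hlogf : Integrable (llr μ volume) μ :=
    (hint.add hquad.neg).congr (by filter_upwards [hllr] with x hx using hx.symm)
  have hf : Integrable (fun x ↦ Real.negMulLog (μ.rnDeriv volume x).toReal) volume := by
    simpa [Real.negMulLog] using ((integrable_rnDeriv_mul_log_iff hvol).2 hlogf).neg
  refine ⟨∫ x, Real.negMulLog (μ.rnDeriv volume x).toReal, ?_, ?_⟩
  · rw [diffEntropy, if_pos hvol, integral_eq_lintegral_pos_part_sub_lintegral_neg_part hf,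
      EReal.coe_sub, EReal.coe_ennreal_toReal hf.lintegral_lt_top.ne,
      EReal.coe_ennreal_toReal (by simpa using hf.neg.lintegral_lt_top.ne)]
  · have e1 : ∫ x, Real.negMulLog (μ.rnDeriv volume x).toReal = -∫ x, llr μ volume x ∂μ := by
      rw [← integral_rnDeriv_mul_log hvol, ← integral_neg]
      simp [Real.negMulLog]
    have e2 : ∫ x, llr μ volume x ∂μ = ∫ x, llr μ (gaussianReal 0 v) x ∂μ
        - ∫ x, (Real.log (Real.sqrt (2 * Real.pi * v)) + x ^ 2 / (2 * v)) ∂μ := by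
      rw [← integral_sub hint hquad]
      exact integral_congr_ae hllr
    have e3 : ∫ x, (Real.log (Real.sqrt (2 * Real.pi * v)) + x ^ 2 / (2 * v)) ∂μ
        = ∫ _, Real.log (Real.sqrt (2 * Real.pi * v)) ∂μ + ∫ x, x ^ 2 / (2 * v) ∂μ :=
      integral_add (integrable_const _) (hμ.integrable_sq.div_const _)
    rw [InformationTheory.toReal_klDiv_of_measure_eq hac (by simp), e1, e2, e3, integral_div, hσ,
      integral_const, probReal_univ, one_smul, Real.log_sqrt (by positivity),
      Real.log_sqrt (by positivity),
      show 2 * Real.pi * Real.exp 1 * (v : ℝ) = 2 * Real.pi * v * Real.exp 1 by ring,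
      Real.log_mul (x := 2 * Real.pi * v) (by positivity) (by positivity), Real.log_exp]
    field_simp
    ring

lemma memLp_and_integral_sq_of_eLpNorm_eq {μ : Measure ℝ} {σ : ℝ} (hσ : 0 ≤ σ)
    (h : eLpNorm id 2 μ = ENNReal.ofReal σ) : MemLp id 2 μ ∧ ∫ x, x ^ 2 ∂μ = σ ^ 2 := by
  have hmem : MemLp (id : ℝ → ℝ) 2 μ :=
    ⟨measurable_id.aestronglyMeasurable, h ▸ ENNReal.ofReal_lt_top⟩
  have hi : Integrable (fun x : ℝ ↦ x ^ 2) μ := hmem.integrable_sq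
  refine ⟨hmem, ?_⟩
  have h2 := lintegral_ofReal_abs_rpow (P := μ) (f := id) two_pos
  simp only [id_eq, Real.rpow_ofNat, sq_abs, ENNReal.ofReal_ofNat, h] at h2
  rw [← ofReal_integral_eq_lintegral_ofReal hi (ae_of_all _ fun x ↦ sq_nonneg x),
    ENNReal.rpow_ofNat, ← ENNReal.ofReal_pow hσ] at h2
  exact (ENNReal.ofReal_eq_ofReal_iff (integral_nonneg fun x ↦ sq_nonneg x) (sq_nonneg σ)).1 h2

lemma coe_le_of_le_ofReal {x : ℝ≥0∞} {y : ℝ} (hy : 0 ≤ y) (h : x ≤ ENNReal.ofReal y) :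
    (x : EReal) ≤ (y : EReal) := by
  have := EReal.coe_ennreal_le_coe_ennreal_iff.2 h
  rwa [EReal.coe_ennreal_ofReal, max_eq_left hy] at this

/-- A rate bound in terms of the second moment becomes a bound on the gap to the Shannon lower
bound in terms of the divergence from the Gaussian. -/
lemma rateDistortion_sub_shannonLowerBound_le {Ω : Type*} [MeasurableSpace Ω] {P : Measure Ω}
    [IsProbabilityMeasure P] {X : Ω → ℝ} (hX : Measurable X) {d r c : ℝ} (hd : 0 ≤ d) (hr : 1 ≤ r)
    (hc : 0 < c) (hpos : 0 < eLpNorm X 2 P)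
    (H : 0 < d → ∀ σ : ℝ, eLpNorm X 2 P = ENNReal.ofReal σ → 0 < σ → MemLp id 2 (P.map X) →
      ∫ x, x ^ 2 ∂(P.map X) = σ ^ 2 → 0 ≤ Real.log (c * σ / (rdAlpha r * d ^ (1 / r))) ∧
      rateDistortion r (P.map X) d
        ≤ ENNReal.ofReal (Real.log (c * σ / (rdAlpha r * d ^ (1 / r))))) :
    (rateDistortion r (P.map X) d : EReal) - shannonLowerBound r (P.map X) d
      ≤ (relEntropyGaussian P X : EReal)
        + (Real.log (c / Real.sqrt (2 * Real.pi * Real.exp 1)) : EReal) := by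
  -- Infinite divergence, including the case `‖X‖₂ = ∞`, makes the right side `⊤`; otherwise the
  -- entropy is real.
  by_cases hD : relEntropyGaussian P X = ⊤
  · rw [hD, EReal.coe_ennreal_top, EReal.top_add_coe]
    exact le_top
  have htop : eLpNorm X 2 P ≠ ⊤ := fun h ↦ hD (by rw [relEntropyGaussian, if_pos h])
  have := Measure.isProbabilityMeasure_map (μ := P) hX.aemeasurable
  rw [relEntropyGaussian, if_neg htop] at hD ⊢
  set σ := (eLpNorm X 2 P).toNNReal with hσ
  have hXσ : eLpNorm X 2 P = ENNReal.ofReal σ := by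
    rw [hσ, ENNReal.ofReal_coe_nnreal, ENNReal.coe_toNNReal htop]
  have hσ0 : 0 < σ := ENNReal.toNNReal_pos hpos.ne' htop
  have hσ0' : (0 : ℝ) < σ := hσ0
  obtain ⟨hmem, hsq⟩ := memLp_and_integral_sq_of_eLpNorm_eq (μ := P.map X) hσ0'.le
    (by rw [eLpNorm_map_measure measurable_id.aestronglyMeasurable hX.aemeasurable, ← hXσ]; rfl)
  obtain ⟨h, hh, hDh⟩ := exists_diffEntropy_eq (v := σ ^ 2) (by positivity) hmem
    (by rw [hsq, NNReal.coe_pow]) hD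
  rw [shannonLowerBound, hh]
  -- At `d = 0` the Shannon lower bound is `⊤`, and `x - ⊤ = ⊥` in `EReal`.
  rcases hd.eq_or_lt with rfl | hd0
  · rw [Real.zero_rpow (by positivity), mul_zero, ENNReal.ofReal_zero, ENNReal.log_zero,
      EReal.coe_sub_bot, EReal.sub_top]
    exact bot_le
  · have hα := rdAlpha_pos (zero_lt_one.trans_le hr)
    have hτ : 0 < d ^ (1 / r) := by positivity
    obtain ⟨h0, hR⟩ := H hd0 σ hXσ hσ0' hmem hsq
    rw [ENNReal.log_ofReal_of_pos (by positivity), ← EReal.coe_ennreal_toReal hD, hDh,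
      ← EReal.coe_sub, ← EReal.coe_add]
    refine (EReal.sub_le_sub (coe_le_of_le_ofReal h0 hR) le_rfl).trans ?_
    -- The term `log(α_r τ)` occurs with opposite signs in the rate and the lower bound and cancels.
    rw [← EReal.coe_sub, EReal.coe_le_coe_iff, NNReal.coe_pow, Real.sqrt_mul (by positivity),
      Real.sqrt_sq hσ0'.le, Real.log_div (by positivity) (by positivity),
      Real.log_div (by positivity) (by positivity), Real.log_mul hc.ne' hσ0'.ne',
      Real.log_mul (x := Real.sqrt _) (by positivity) hσ0'.ne']
    linarith

/-! ### The cases of the theorem. -/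

theorem theorem8 {Ω : Type*} [MeasurableSpace Ω] (P : Measure Ω) [IsProbabilityMeasure P]
    (X : Ω → ℝ) (hX : Measurable X) (d r : ℝ) (hd : 0 ≤ d) (hr : 1 ≤ r) :
    (r ≤ 2 →
      (ENNReal.ofReal (d ^ (1 / r)) < eLpNorm X 2 P →
        (rateDistortion r (P.map X) d : EReal) - shannonLowerBound r (P.map X) d
          ≤ (relEntropyGaussian P X : EReal)
            + (Real.log (rdAlpha r / Real.sqrt (2 * Real.pi * Real.exp 1)) : EReal)) ∧
      (eLpNorm X 2 P ≤ ENNReal.ofReal (d ^ (1 / r)) →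
        rateDistortion r (P.map X) d = 0)) ∧
    (2 < r →
      (ENNReal.ofReal (d ^ (1 / r)) ≤ eLpNorm X 2 P → 0 < eLpNorm X 2 P →
        (rateDistortion r (P.map X) d : EReal) - shannonLowerBound r (P.map X) d
          ≤ (relEntropyGaussian P X : EReal) + (Real.log (rdBeta r) : EReal)) ∧
      (eLpNorm X (ENNReal.ofReal r) P ≤ ENNReal.ofReal (d ^ (1 / r)) →
        rateDistortion r (P.map X) d = 0) ∧
      (ENNReal.ofReal (d ^ (1 / r)) < eLpNorm X (ENNReal.ofReal r) P →
        eLpNorm X 2 P < ENNReal.ofReal (d ^ (1 / r)) →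
        (rateDistortion r (P.map X) d : EReal)
          ≤ (Real.log (Real.sqrt (2 * Real.pi * Real.exp 1) * rdBeta r / rdAlpha r) : EReal))) := by
  have hr0 : 0 < r := by linarith
  have := Measure.isProbabilityMeasure_map (μ := P) hX.aemeasurable
  have hnorm : ∀ q : ℝ≥0∞, eLpNorm id q (P.map X) = eLpNorm X q P := fun q ↦ by
    rw [eLpNorm_map_measure measurable_id.aestronglyMeasurable hX.aemeasurable]
    rfl
  refine ⟨fun hr2 ↦ ⟨fun hlt ↦ ?_, fun hle ↦ ?_⟩, fun hr2 ↦ ⟨fun hle hpos ↦ ?_, fun hle ↦ ?_,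
    fun hlt hle ↦ ?_⟩⟩
  · refine rateDistortion_sub_shannonLowerBound_le hX hd hr (rdAlpha_pos hr0)
      (zero_le.trans_lt hlt) fun hd0 σ hσ hσ0 hmem hsq ↦ ?_
    rw [hσ, ENNReal.ofReal_lt_ofReal_iff hσ0] at hlt
    exact rateDistortion_le_of_le_two hr hr2 hd0 hmem hsq hlt
  · refine rateDistortion_eq_zero hr0 hd ?_
    refine le_trans ?_ hle
    rw [hnorm]
    refine eLpNorm_le_eLpNorm_of_exponent_le ?_ hX.aestronglyMeasurable
    simpa using ENNReal.ofReal_le_ofReal hr2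
  · have hβ : 0 < rdBeta r := zero_lt_one.trans (one_lt_rdBeta hr0)
    have hπ : 0 < Real.sqrt (2 * Real.pi * Real.exp 1) := by positivity
    have h := rateDistortion_sub_shannonLowerBound_le hX hd hr (mul_pos hπ hβ) hpos
      fun hd0 σ hσ hσ0 hmem hsq ↦ by
        rw [hσ, ENNReal.ofReal_le_ofReal_iff hσ0.le] at hle
        exact rateDistortion_le_of_max hr hd0 hmem hsq hσ0.le le_rfl hle
    rwa [mul_div_cancel_left₀ _ hπ.ne'] at h
  · exact rateDistortion_eq_zero hr0 hd (by rwa [hnorm])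
  · have hτ : 0 < d ^ (1 / r) := by
      rw [← ENNReal.ofReal_pos]
      exact zero_le.trans_lt hle
    -- A norm strictly below `τ` forces `τ > 0`, hence `d > 0`.
    have hd0 : 0 < d := hd.lt_of_ne fun h ↦ by
      rw [← h, Real.zero_rpow (by positivity)] at hτ
      exact hτ.false
    have htop : eLpNorm X 2 P ≠ ⊤ := (hle.trans ENNReal.ofReal_lt_top).ne
    obtain ⟨hmem, hsq⟩ := memLp_and_integral_sq_of_eLpNorm_eq (μ := P.map X)
      (σ := (eLpNorm X 2 P).toReal) ENNReal.toReal_nonneg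
      (by rw [hnorm, ENNReal.ofReal_toReal htop])
    -- Here `σ < τ`, so `b = τ`, which cancels against the `τ` in the denominator.
    obtain ⟨h0, hR⟩ := rateDistortion_le_of_max hr hd0 hmem hsq ENNReal.toReal_nonneg
      (ENNReal.toReal_le_of_le_ofReal hτ.le hle.le) le_rfl
    rw [mul_div_mul_right _ _ hτ.ne'] at h0 hR
    exact coe_le_of_le_ofReal h0 hR
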